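/- Let $1\le s\le d$ be integers and $\sigma>0$. One observes $y_j=\theta_j+\sigma\xi_j$, $j=1,\dots,d$, with $\xi_j$ i.i.d. standard normal and $\theta\in\mathbb R^d$ unknown; $\mathbf P_\theta$ is the law of $y=(y_1,\dots,y_d)$. Let $\|\theta\|_0$ be the number of non-zero components of $\theta$, and for $\delta>0$ put $$\Theta_s(\delta)=\{\theta\in\mathbb R^d:\ \|\theta\|_0=s,\ \theta_j\in\{0,\delta\},\ j=1,\dots,d\},\qquad \Theta_s^*(\delta)=\Big\{\theta\in\mathbb R^d:\ \|\theta\|_0=s,\ \min_{j:\,\theta_j\neq0}|\theta_j|\ge\delta\Big\}.$$ For $\Theta\subseteq\mathbb R^d$, the minimax risk of testing $\theta=0$ against $\theta\in\Theta$ is $$\mathcal R(\Theta)=\inf_\Delta\Big\{\mathbf P_0(\Delta=1)+\sup_{\theta\in\Theta}\mathbf P_\theta(\Delta=0)\Big\},$$ where the infimum is over all $\{0,1\}$-valued statistics $\Delta=\Delta(y)$. A quantity $\lambda=\lambda(s,d,\sigma)>0$ is called the minimax rate of testing on the classes $\Theta_s$ (over a given range of $(s,d)$ and all $\sigma>0$)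 if (i) for any $\varepsilon\in(0,1)$ there exists $A_\varepsilon>0$ such that $\mathcal R(\Theta_s(A\lambda))\le\varepsilon$ for all $A>A_\varepsilon$; (ii) for any $\varepsilon\in(0,1)$ there exists $a_\varepsilon>0$ such that $\mathcal R(\Theta_s(A\lambda))\ge1-\varepsilon$ for all $0<A<a_\varepsilon$; where $A_\varepsilon$ and $a_\varepsilon$ depend only on $\varepsilon$, and not on $s,d,\sigma$. The minimax rate of testing on the classes $\Theta_s^*$ is defined in the same way. Then the minimax rate of testing on $\Theta_s$ is $\lambda=\sigma\sqrt{\log(1+d/s^2)}$ for $s\le\sqrt d$, and the minimax rate of testing on $\Theta_s^*$ is $$\lambda=\begin{cases}\sigma\sqrt{\log(1+d/s^2)} & \text{if } s<\sqrt d,\\ \sigma d^{1/4}/\sqrt s & \text{if } s\ge\sqrt d.\end{cases}$$ -/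

import Mathlib

open MeasureTheory ProbabilityTheory
open scoped ENNReal

noncomputable section

/-- The law `P_θ` on `ℝ^d` of the observations `y_j = θ_j + σ ξ_j`, `j = 1, …, d`, with `ξ_j` i.i.d.
standard normal: the `y_j` are independent and `y_j ∼ N(θ_j, σ²)`. -/
def obsLaw (d : ℕ) (σ : ℝ) (θ : Fin d → ℝ) : Measure (Fin d → ℝ) :=
  Measure.pi fun j => gaussianReal (θ j) (Real.toNNReal (σ ^ 2))

/-- The number `‖θ‖₀` of non-zero components of `θ`. -/
def numNonzero {d : ℕ} (θ : Fin d → ℝ) : ℕ :=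
  (Finset.univ.filter fun j => θ j ≠ 0).card

/-- The class `Θ_s(δ)`: `s` components of `θ` are non-zero and all components lie in `{0, δ}`. -/
def thetaClass (d s : ℕ) (δ : ℝ) : Set (Fin d → ℝ) :=
  {θ | numNonzero θ = s ∧ ∀ j, θ j = 0 ∨ θ j = δ}

/-- The class `Θ*_s(δ)`: `s` components of `θ` are non-zero, and these have absolute value at
least `δ`. -/
def thetaStarClass (d s : ℕ) (δ : ℝ) : Set (Fin d → ℝ) :=
  {θ | numNonzero θ = s ∧ ∀ j, θ j ≠ 0 → δ ≤ |θ j|}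

/-- The risk of a test `Δ` of `θ = 0` against `θ ∈ Θ`: the first type error plus the maximum second
type error. -/
def testRisk (d : ℕ) (σ : ℝ) (Θ : Set (Fin d → ℝ)) (Δ : (Fin d → ℝ) → Fin 2) : ℝ≥0∞ :=
  obsLaw d σ 0 {y | Δ y = 1} + ⨆ θ ∈ Θ, obsLaw d σ θ {y | Δ y = 0}

/-- The minimax risk of testing `θ = 0` against `θ ∈ Θ`: the infimum of the risk over all
`{0,1}`-valued statistics, that is, measurable functions of the observations. -/
def minimaxTestRisk (d : ℕ) (σ : ℝ) (Θ : Set (Fin d → ℝ)) : ℝ≥0∞ :=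
  ⨅ (Δ : (Fin d → ℝ) → Fin 2) (_ : Measurable Δ), testRisk d σ Θ Δ

/-- `rate d s σ` is the (non-asymptotic) minimax rate of testing on the classes `Θ d s`, for all
`σ > 0` and all pairs `(d, s)` in the range `R`. The constants depend on `ε` only. -/
def IsMinimaxTestingRate (R : ℕ → ℕ → Prop) (Θ : (d s : ℕ) → ℝ → Set (Fin d → ℝ))
    (rate : ℕ → ℕ → ℝ → ℝ) : Prop :=
  (∀ (d s : ℕ) (σ : ℝ), R d s → 0 < σ → 0 < rate d s σ) ∧
  (∀ ε : ℝ, 0 < ε → ε < 1 → ∃ A₀ : ℝ, 0 < A₀ ∧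
    ∀ (d s : ℕ) (σ : ℝ), R d s → 0 < σ → ∀ A : ℝ, A₀ < A →
      minimaxTestRisk d σ (Θ d s (A * rate d s σ)) ≤ ENNReal.ofReal ε) ∧
  (∀ ε : ℝ, 0 < ε → ε < 1 → ∃ a₀ : ℝ, 0 < a₀ ∧
    ∀ (d s : ℕ) (σ : ℝ), R d s → 0 < σ → ∀ A : ℝ, 0 < A → A < a₀ →
      ENNReal.ofReal (1 - ε) ≤ minimaxTestRisk d σ (Θ d s (A * rate d s σ)))

end

/-! Lower bounds: the likelihood ratio of a uniform mixture over a finite family in the alternative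
has second moment under noise equal to the average of exp(⟨θ, θ'⟩/σ²). If this is at most 1 + ε², no
test has risk below 1 - ε. The prior splits s·⌊d/s⌋ coordinates into s blocks of length m = ⌊d/s⌋
and puts one non-zero entry, uniformly placed, in each. Blocks are independent, so the second moment
is at most (1 + w/m)^s ≤ exp(2s²w/d), where 1 + w bounds the mean of exp(vv'/σ²) over pairs of entry
values. A fixed value δ gives w = (1 + d/s²)^(A²) - 1 ≤ A²d/s², the logarithmic rate. Random signs
±δ cancel the first-order term and give w = cosh(δ²/σ²) - 1 ≤ A⁴d/s², the dense rate
(`le_minimaxTestRisk_of_block`).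

Upper bounds: Chebyshev's inequality for ∑ f(y_j) (`minimaxTestRisk_le_of_statistic`). In the sparse
range f counts the coordinates with |y_j| ≥ δ/2; Gaussian tails make the variance small against s².
In the dense range f is the square; the mean shifts by at least A²√d, while the noise standard
deviation is of order √d.

Since `thetaClass` lies in `thetaStarClass`, the sparse lower bound is proved for the former, the
sparse upper bound for the latter, and each serves both classes. -/

/-! ### Second-moment bound for testing against a mixture -/

/-- Le Cam's two-point bound: a test cannot separate a law from a mixture that is close to it
in the chi-square sense. -/
lemma one_sub_le_of_chiSq {Ω : Type*} [MeasurableSpace Ω] (P : Measure Ω) [IsProbabilityMeasure P]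
    {g : Ω → ℝ} (hg : Integrable g P) (hg2 : Integrable (fun ω => g ω ^ 2) P)
    (h1 : ∫ ω, g ω ∂P = 1) {ε : ℝ} (hε : 0 < ε) (h2 : ∫ ω, g ω ^ 2 ∂P ≤ 1 + ε ^ 2)
    {B : Set Ω} (hB : MeasurableSet B) :
    1 - ε ≤ P.real B + ∫ ω in Bᶜ, g ω ∂P := by
  have hint : Integrable (fun ω => (1 - g ω) ^ 2) P := by
    have : (fun ω => (1 - g ω) ^ 2) = fun ω => 1 - 2 * g ω + g ω ^ 2 := by ext; ring
    rw [this]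
    exact ((integrable_const _).sub (hg.const_mul 2)).add hg2
  have hsq : ∫ ω, (1 - g ω) ^ 2 ∂P ≤ ε ^ 2 := by
    have : (fun ω => (1 - g ω) ^ 2) = fun ω => 1 - 2 * g ω + g ω ^ 2 := by ext; ring
    have hsub : Integrable (fun ω => 1 - 2 * g ω) P :=
      (integrable_const _).sub (hg.const_mul 2)
    rw [this, integral_add hsub hg2, integral_sub (integrable_const _) (hg.const_mul 2), integral_const_mul, h1]
    simp
    linarith
  have habs : ∫ ω, |1 - g ω| ∂P ≤ ε := by
    -- The inequality |x| ≤ x²/(2ε) + ε/2 takes the place of Cauchy–Schwarz.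
    have hle : ∫ ω, |1 - g ω| ∂P ≤ ∫ ω, ((1 - g ω) ^ 2 * (1 / (2 * ε)) + ε / 2) ∂P := by
      refine integral_mono ((integrable_const _).sub hg).abs
        ((hint.mul_const _).add (integrable_const _)) fun ω => ?_
      have : 0 ≤ (|1 - g ω| - ε) ^ 2 := sq_nonneg _
      rw [sub_sq, sq_abs] at this
      change |1 - g ω| ≤ (1 - g ω) ^ 2 * (1 / (2 * ε)) + ε / 2
      have h3 : (1 - g ω) ^ 2 * (1 / (2 * ε)) + ε / 2 = ((1 - g ω) ^ 2 + ε ^ 2) / (2 * ε) := by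
        field_simp
      rw [h3, le_div_iff₀ (by positivity)]
      linarith
    rw [integral_add (hint.mul_const _) (integrable_const _), integral_mul_const] at hle
    simp only [integral_const, probReal_univ, one_smul] at hle
    have : (∫ ω, (1 - g ω) ^ 2 ∂P) * (1 / (2 * ε)) ≤ ε ^ 2 * (1 / (2 * ε)) := by gcongr
    have h3 : ε ^ 2 * (1 / (2 * ε)) = ε / 2 := by field_simp
    linarith
  have hc : ∫ ω in Bᶜ, (1 - g ω) ∂P ≤ ε := by
    refine le_trans ?_ habs
    refine (integral_mono ((integrable_const _).sub hg).integrableOn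
      ((integrable_const _).sub hg).abs.integrableOn fun ω => le_abs_self _).trans ?_
    exact setIntegral_le_integral ((integrable_const _).sub hg).abs
      (Filter.Eventually.of_forall fun _ => abs_nonneg _)
  rw [integral_sub (integrable_const _).integrableOn hg.integrableOn] at hc
  simp only [integral_const, measureReal_restrict_apply_univ, smul_eq_mul, mul_one] at hc
  have := probReal_compl_eq_one_sub (μ := P) hB
  linarith

/-! ### Gaussian likelihood ratios and their inner products -/

/-- Likelihood ratio of `N(a, v)` with respect to `N(0, v)`. -/
noncomputable def gaussianLR (v a x : ℝ) : ℝ := Real.exp ((a * x - a ^ 2 / 2) / v)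

lemma gaussianLR_nonneg (v a x : ℝ) : 0 ≤ gaussianLR v a x := (Real.exp_pos _).le

lemma measurable_gaussianLR (v a : ℝ) : Measurable (gaussianLR v a) := by
  unfold gaussianLR; fun_prop

lemma gaussianReal_eq_withDensity_gaussianLR (a : ℝ) {v : NNReal} (hv : v ≠ 0) :
    gaussianReal a v =
      (gaussianReal 0 v).withDensity fun x => ENNReal.ofReal (gaussianLR v a x) := by
  rw [gaussianReal_of_var_ne_zero _ hv, gaussianReal_of_var_ne_zero _ hv,
    ← withDensity_mul _ (measurable_gaussianPDF _ _)
      (measurable_gaussianLR _ _).ennreal_ofReal]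
  congr 1
  ext x
  have hv' : (v : ℝ) ≠ 0 := by exact_mod_cast hv
  simp only [Pi.mul_apply, gaussianPDF_def, gaussianPDFReal_def, gaussianLR]
  rw [← ENNReal.ofReal_mul (by positivity), mul_assoc (√_)⁻¹, ← Real.exp_add]
  congr 3
  field_simp
  ring

lemma gaussianLR_eq (v : ℝ) (a x : ℝ) :
    gaussianLR v a x = Real.exp (-(a ^ 2 / 2 / v)) * Real.exp (a / v * x) := by
  rw [gaussianLR, ← Real.exp_add]; congr 1; ring

lemma gaussianLR_mul_eq (v : ℝ) (a b x : ℝ) :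
    gaussianLR v a x * gaussianLR v b x =
      Real.exp (-((a ^ 2 + b ^ 2) / 2 / v)) * Real.exp ((a + b) / v * x) := by
  rw [gaussianLR, gaussianLR, ← Real.exp_add, ← Real.exp_add]; congr 1; ring

lemma integrable_gaussianLR (v : NNReal) (a : ℝ) :
    Integrable (gaussianLR v a) (gaussianReal 0 v) := by
  have : gaussianLR v a = fun x => Real.exp (-(a ^ 2 / 2 / v)) * Real.exp (a / v * x) :=
    funext (gaussianLR_eq v a)
  rw [this]
  exact (integrable_exp_mul_gaussianReal _).const_mul _

lemma integrable_gaussianLR_mul (v : NNReal) (a b : ℝ) :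
    Integrable (fun x => gaussianLR v a x * gaussianLR v b x) (gaussianReal 0 v) := by
  simp_rw [gaussianLR_mul_eq]
  exact (integrable_exp_mul_gaussianReal _).const_mul _

/-- The product is an exponential in x, so the integral is the Gaussian moment generating function
at (a + b)/v; the squares cancel and only the cross term survives. -/
lemma integral_gaussianLR_mul {v : NNReal} (hv : v ≠ 0) (a b : ℝ) :
    ∫ x, gaussianLR v a x * gaussianLR v b x ∂gaussianReal 0 v = Real.exp (a * b / v) := by
  have hv' : (v : ℝ) ≠ 0 := by exact_mod_cast hv
  simp_rw [gaussianLR_mul_eq]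
  rw [integral_const_mul]
  have := congrFun (mgf_fun_id_gaussianReal (μ := 0) (v := v)) ((a + b) / v)
  rw [mgf] at this
  rw [this, ← Real.exp_add]
  congr 1
  field_simp
  ring

/-- Likelihood ratio of `obsLaw d σ θ` with respect to `obsLaw d σ 0`. -/
noncomputable def obsLR {d : ℕ} (σ : ℝ) (θ y : Fin d → ℝ) : ℝ :=
  ∏ j, gaussianLR (Real.toNNReal (σ ^ 2)) (θ j) (y j)

instance isProbabilityMeasure_obsLaw (d : ℕ) (σ : ℝ) (θ : Fin d → ℝ) :
    IsProbabilityMeasure (obsLaw d σ θ) := by unfold obsLaw; infer_instance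

lemma obsLR_nonneg {d : ℕ} (σ : ℝ) (θ y : Fin d → ℝ) : 0 ≤ obsLR σ θ y :=
  Finset.prod_nonneg fun _ _ => gaussianLR_nonneg _ _ _

lemma integrable_obsLR {d : ℕ} (σ : ℝ) (θ : Fin d → ℝ) :
    Integrable (obsLR σ θ) (obsLaw d σ 0) :=
  Integrable.fintype_prod_dep fun _ => integrable_gaussianLR _ _

lemma obsLR_mul {d : ℕ} (σ : ℝ) (θ η y : Fin d → ℝ) : obsLR σ θ y * obsLR σ η y =
    ∏ j, gaussianLR (Real.toNNReal (σ ^ 2)) (θ j) (y j) *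
      gaussianLR (Real.toNNReal (σ ^ 2)) (η j) (y j) :=
  Finset.prod_mul_distrib.symm

lemma integrable_obsLR_mul {d : ℕ} (σ : ℝ) (θ η : Fin d → ℝ) :
    Integrable (fun y => obsLR σ θ y * obsLR σ η y) (obsLaw d σ 0) := by
  simp_rw [obsLR_mul]
  exact Integrable.fintype_prod_dep (f := fun j x => gaussianLR (Real.toNNReal (σ ^ 2)) (θ j) x *
      gaussianLR (Real.toNNReal (σ ^ 2)) (η j) x) fun _ => integrable_gaussianLR_mul _ _ _

lemma integral_obsLR_mul {d : ℕ} {σ : ℝ} (hσ : 0 < σ) (θ η : Fin d → ℝ) :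
    ∫ y, obsLR σ θ y * obsLR σ η y ∂obsLaw d σ 0 = Real.exp ((∑ j, θ j * η j) / σ ^ 2) := by
  simp_rw [obsLR_mul]
  unfold obsLaw
  have hv : Real.toNNReal (σ ^ 2) ≠ 0 := by
    rw [Ne, Real.toNNReal_eq_zero, not_le]; positivity
  rw [integral_fintype_prod_eq_prod (𝕜 := ℝ) (fun j x =>
    gaussianLR (Real.toNNReal (σ ^ 2)) (θ j) x * gaussianLR (Real.toNNReal (σ ^ 2)) (η j) x)]
  simp only [Pi.zero_apply]
  rw [Finset.sum_div, Real.exp_sum]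
  refine Finset.prod_congr rfl fun j _ => ?_
  rw [integral_gaussianLR_mul hv, Real.coe_toNNReal _ (sq_nonneg σ)]

/-- It suffices to compare the measures on boxes. There the density times the indicator is a product
of functions of single coordinates, so the integral factorises. -/
lemma obsLaw_eq_withDensity {d : ℕ} {σ : ℝ} (hσ : 0 < σ) (θ : Fin d → ℝ) :
    obsLaw d σ θ = (obsLaw d σ 0).withDensity fun y => ENNReal.ofReal (obsLR σ θ y) := by
  have hv : Real.toNNReal (σ ^ 2) ≠ 0 := by
    rw [Ne, Real.toNNReal_eq_zero, not_le]; positivity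
  refine Measure.pi_eq fun B hB => ?_
  have hm := fun j => (measurable_gaussianLR (Real.toNNReal (σ ^ 2)) (θ j)).ennreal_ofReal
  have hind := iIndepFun_pi (μ := fun _ : Fin d => gaussianReal 0 (Real.toNNReal (σ ^ 2)))
    (X := fun j x => (B j).indicator
      (fun x => ENNReal.ofReal (gaussianLR (Real.toNNReal (σ ^ 2)) (θ j) x)) x)
    (fun j => ((hm j).indicator (hB j)).aemeasurable)
  rw [withDensity_apply _ (MeasurableSet.univ_pi hB),
    ← lintegral_indicator (MeasurableSet.univ_pi hB)]
  have hprod : (Set.univ.pi B).indicator (fun y => ENNReal.ofReal (obsLR σ θ y)) = fun y =>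
      ∏ j, (B j).indicator
        (fun x => ENNReal.ofReal (gaussianLR (Real.toNNReal (σ ^ 2)) (θ j) x)) (y j) := by
    ext y
    by_cases hy : y ∈ Set.univ.pi B
    · rw [Set.indicator_of_mem hy, obsLR,
        ENNReal.ofReal_prod_of_nonneg fun _ _ => gaussianLR_nonneg _ _ _]
      exact Finset.prod_congr rfl fun j _ => by rw [Set.indicator_of_mem (hy j trivial)]
    · rw [Set.indicator_of_notMem hy]
      simp only [Set.mem_univ_pi, not_forall] at hy
      obtain ⟨j, hj⟩ := hy
      exact (Finset.prod_eq_zero (Finset.mem_univ j) (Set.indicator_of_notMem hj _)).symm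
  rw [hprod]
  simp only [obsLaw, Pi.zero_apply]
  rw [lintegral_prod_eq_prod_lintegral_of_indepFun Finset.univ _ hind
    fun j => ((hm j).indicator (hB j)).comp (measurable_pi_apply j)]
  refine Finset.prod_congr rfl fun j _ => ?_
  have hmp := measurePreserving_eval
    (fun _ : Fin d => gaussianReal 0 (Real.toNNReal (σ ^ 2))) j
  have := hmp.lintegral_comp ((hm j).indicator (hB j))
  simp only [Function.eval] at this
  rw [this, lintegral_indicator (hB j), gaussianReal_eq_withDensity_gaussianLR (θ j) hv,
    withDensity_apply _ (hB j)]

/-! ### Lower bounds from finite and block priors -/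

/-- Lower bound for the minimax risk by means of the uniform prior on a finite family. -/
lemma le_minimaxTestRisk_of_family {d : ℕ} {σ : ℝ} (hσ : 0 < σ) {Θ : Set (Fin d → ℝ)}
    {ι : Type*} [Fintype ι] [Nonempty ι] (θ : ι → Fin d → ℝ) (hθ : ∀ i, θ i ∈ Θ)
    {ε : ℝ} (hε : 0 < ε)
    (h : ∑ i, ∑ k, Real.exp ((∑ j, θ i j * θ k j) / σ ^ 2) ≤
      (Fintype.card ι : ℝ) ^ 2 * (1 + ε ^ 2)) :
    ENNReal.ofReal (1 - ε) ≤ minimaxTestRisk d σ Θ := by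
  unfold minimaxTestRisk
  refine le_iInf₂ fun Δ hΔ => ?_
  set P := obsLaw d σ 0 with hP
  have hN : (0 : ℝ) < Fintype.card ι := by exact_mod_cast Fintype.card_pos
  set N : ℝ := (Fintype.card ι : ℝ) with hNdef
  set g : (Fin d → ℝ) → ℝ := fun y => N⁻¹ * ∑ i, obsLR σ (θ i) y with hgdef
  have hLR1 : ∀ η : Fin d → ℝ, ∀ B, MeasurableSet B →
      ∫ y in B, obsLR σ η y ∂P = (obsLaw d σ η).real B := by
    intro η B hB
    rw [Measure.real, obsLaw_eq_withDensity hσ η, withDensity_apply _ hB,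
      integral_eq_lintegral_of_nonneg_ae (Filter.Eventually.of_forall fun _ => obsLR_nonneg _ _ _)
        (integrable_obsLR σ η).aestronglyMeasurable.restrict]
  have hg : Integrable g P := (integrable_finsetSum _ fun i _ => integrable_obsLR σ _).const_mul _
  have hgsq : (fun y => g y ^ 2) =
      fun y => (N ^ 2)⁻¹ * ∑ i, ∑ k, obsLR σ (θ i) y * obsLR σ (θ k) y := by
    ext y
    rw [hgdef, mul_pow, inv_pow, sq (∑ i, obsLR σ (θ i) y), Finset.sum_mul_sum]
  have hg2 : Integrable (fun y => g y ^ 2) P := by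
    rw [hgsq]
    exact (integrable_finsetSum _ fun i _ => integrable_finsetSum _ fun k _ =>
      integrable_obsLR_mul σ _ _).const_mul _
  have hset : ∀ B, MeasurableSet B →
      ∫ y in B, g y ∂P = N⁻¹ * ∑ i, (obsLaw d σ (θ i)).real B := by
    intro B hB
    rw [hgdef, integral_const_mul,
      integral_finsetSum _ fun i _ => (integrable_obsLR σ _).integrableOn]
    exact congrArg _ (Finset.sum_congr rfl fun i _ => hLR1 _ B hB)
  have h1 : ∫ y, g y ∂P = 1 := by
    rw [← setIntegral_univ, hset _ MeasurableSet.univ]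
    simp only [probReal_univ, Finset.sum_const, Finset.card_univ, nsmul_eq_mul, mul_one]
    exact inv_mul_cancel₀ hN.ne'
  have h2 : ∫ y, g y ^ 2 ∂P ≤ 1 + ε ^ 2 := by
    rw [hgsq, integral_const_mul, integral_finsetSum _ fun i _ =>
      integrable_finsetSum _ fun k _ => integrable_obsLR_mul σ _ _]
    rw [inv_mul_le_iff₀ (by positivity)]
    refine (Finset.sum_congr rfl fun i _ => ?_).trans_le h
    rw [integral_finsetSum _ fun k _ => integrable_obsLR_mul σ _ (θ k)]
    exact Finset.sum_congr rfl fun k _ => integral_obsLR_mul hσ _ _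
  have hB : MeasurableSet {y | Δ y = 1} := hΔ (measurableSet_singleton 1)
  have hBc : {y | Δ y = 1}ᶜ = {y | Δ y = 0} := by
    ext y; simp only [Set.mem_compl_iff, Set.mem_ofPred_eq]; omega
  have key := one_sub_le_of_chiSq P hg hg2 h1 hε h2 hB
  rw [hset _ hB.compl, hBc] at key
  -- Some member of the family has a second type error at least the average.
  obtain ⟨i, -, hi⟩ : ∃ i ∈ (Finset.univ : Finset ι),
      N⁻¹ * ∑ i, (obsLaw d σ (θ i)).real {y | Δ y = 0} ≤
        (obsLaw d σ (θ i)).real {y | Δ y = 0} := by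
    refine Finset.exists_le_of_sum_le Finset.univ_nonempty ?_
    simp only [Finset.sum_const, Finset.card_univ, nsmul_eq_mul]
    rw [← hNdef, mul_inv_cancel_left₀ hN.ne']
  calc ENNReal.ofReal (1 - ε)
      ≤ ENNReal.ofReal (P.real {y | Δ y = 1} + (obsLaw d σ (θ i)).real {y | Δ y = 0}) :=
        ENNReal.ofReal_le_ofReal (by linarith)
    _ = P {y | Δ y = 1} + obsLaw d σ (θ i) {y | Δ y = 0} := by
        rw [ENNReal.ofReal_add measureReal_nonneg measureReal_nonneg, ofReal_measureReal,
          ofReal_measureReal]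
    _ ≤ testRisk d σ Θ Δ := by
        unfold testRisk
        gcongr
        exact le_iSup₂ (f := fun θ (_ : θ ∈ Θ) => obsLaw d σ θ {y | Δ y = 0}) (θ i) (hθ i)

section BlockPrior

variable {d s m : ℕ} {β : Type*}

/-- The vector with one non-zero entry in each of `s` disjoint blocks of `m` coordinates: in
block `i` it has the value `v (f i).2` at the position `(f i).1`. -/
noncomputable def blockVector (e : Fin s × Fin m ↪ Fin d) (v : β → ℝ)
    (f : Fin s → Fin m × β) : Fin d → ℝ :=
  Function.extend e (fun x => if (f x.1).1 = x.2 then v (f x.1).2 else 0) 0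

lemma blockVector_apply (e : Fin s × Fin m ↪ Fin d) (v : β → ℝ) (f : Fin s → Fin m × β)
    (x : Fin s × Fin m) :
    blockVector e v f (e x) = if (f x.1).1 = x.2 then v (f x.1).2 else 0 :=
  e.injective.extend_apply _ _ _

lemma blockVector_eq_zero (e : Fin s × Fin m ↪ Fin d) (v : β → ℝ) (f : Fin s → Fin m × β)
    {j : Fin d} (hj : ¬ ∃ x, e x = j) : blockVector e v f j = 0 :=
  Function.extend_apply' _ _ _ hj

lemma blockVector_eq_zero_or (e : Fin s × Fin m ↪ Fin d) (v : β → ℝ) (f : Fin s → Fin m × β)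
    (j : Fin d) : blockVector e v f j = 0 ∨ ∃ b, blockVector e v f j = v b := by
  by_cases hj : ∃ x, e x = j
  · obtain ⟨x, rfl⟩ := hj
    rw [blockVector_apply]
    split_ifs
    · exact Or.inr ⟨_, rfl⟩
    · exact Or.inl rfl
  · exact Or.inl (blockVector_eq_zero e v f hj)

lemma numNonzero_blockVector (e : Fin s × Fin m ↪ Fin d) {v : β → ℝ} (hv : ∀ b, v b ≠ 0)
    (f : Fin s → Fin m × β) : numNonzero (blockVector e v f) = s := by
  have hinj : Function.Injective fun i : Fin s => e (i, (f i).1) := fun i k h =>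
    congrArg Prod.fst (e.injective h)
  have : (Finset.univ.filter fun j => blockVector e v f j ≠ 0) =
      Finset.univ.map ⟨fun i : Fin s => e (i, (f i).1), hinj⟩ := by
    ext j
    simp only [Finset.mem_filter, Finset.mem_univ, true_and, Finset.mem_map,
      Function.Embedding.coeFn_mk]
    constructor
    · intro h
      by_cases hj : ∃ x, e x = j
      · obtain ⟨x, rfl⟩ := hj
        rw [blockVector_apply] at h
        by_cases hx : (f x.1).1 = x.2
        · exact ⟨x.1, by rw [hx]⟩
        · exact absurd (if_neg hx) h
      · exact absurd (blockVector_eq_zero e v f hj) h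
    · rintro ⟨i, rfl⟩
      rw [blockVector_apply, if_pos rfl]
      exact hv _
  rw [numNonzero, this, Finset.card_map, Finset.card_univ, Fintype.card_fin]

lemma sum_blockVector_mul (e : Fin s × Fin m ↪ Fin d) (v : β → ℝ) (f g : Fin s → Fin m × β) :
    ∑ j, blockVector e v f j * blockVector e v g j =
      ∑ i, if (f i).1 = (g i).1 then v (f i).2 * v (g i).2 else 0 := by
  have h : ∑ j ∈ Finset.univ.map e, blockVector e v f j * blockVector e v g j =
      ∑ j, blockVector e v f j * blockVector e v g j := by
    refine Finset.sum_subset (Finset.subset_univ _) fun j _ hj => ?_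
    rw [blockVector_eq_zero e v f, zero_mul]
    simpa using hj
  rw [← h, Finset.sum_map, Fintype.sum_prod_type]
  refine Finset.sum_congr rfl fun i _ => ?_
  simp only [blockVector_apply]
  rw [Finset.sum_eq_single (f i).1]
  · simp only [if_true, mul_ite, mul_zero, eq_comm]
  · intro k _ hk
    rw [if_neg hk.symm, zero_mul]
  · simp

/-- The exponential factorises over blocks, so the double sum is an s-th power. In one block, pairs
at different positions contribute 1 each; the m coinciding positions correct this by the excess of
the exponential over 1. -/
lemma sum_sum_exp_blockVector [Fintype β] (e : Fin s × Fin m ↪ Fin d) (v : β → ℝ) (c : ℝ) :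
    ∑ f, ∑ g, Real.exp ((∑ j, blockVector e v f j * blockVector e v g j) / c) =
      ((m : ℝ) ^ 2 * (Fintype.card β : ℝ) ^ 2 +
        m * ((∑ a, ∑ b, Real.exp (v a * v b / c)) - (Fintype.card β : ℝ) ^ 2)) ^ s := by
  set w : Fin m × β → Fin m × β → ℝ := fun x y =>
    Real.exp ((if x.1 = y.1 then v x.2 * v y.2 else 0) / c) with hw
  have h1 : ∀ f g : Fin s → Fin m × β,
      Real.exp ((∑ j, blockVector e v f j * blockVector e v g j) / c) = ∏ i, w (f i) (g i) := by
    intro f g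
    rw [sum_blockVector_mul, Finset.sum_div, Real.exp_sum]
  have h2 : ∀ f : Fin s → Fin m × β, ∑ g : Fin s → Fin m × β, ∏ i, w (f i) (g i) =
      ∏ i, ∑ y, w (f i) y := fun f => (Fintype.prod_sum _).symm
  have h3 : ∀ x y, w x y = 1 + if x.1 = y.1 then Real.exp (v x.2 * v y.2 / c) - 1 else 0 := by
    intro x y
    simp only [hw]
    split_ifs <;> simp
  simp_rw [h1, h2]
  rw [← Fintype.sum_pow (fun x => ∑ y, w x y)]
  congr 1
  have h4 : ∀ (p : Fin m) (a : β), ∑ q, ∑ b,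
      (if p = q then Real.exp (v a * v b / c) - 1 else 0) =
        ∑ b, (Real.exp (v a * v b / c) - 1) := by
    intro p a
    rw [Finset.sum_comm]
    simp
  simp_rw [h3, Fintype.sum_prod_type, Finset.sum_add_distrib, h4]
  simp only [Finset.sum_const, Finset.card_univ, Fintype.card_fin, nsmul_eq_mul, mul_one,
    Finset.sum_sub_distrib]
  ring

/-- Lower bound for the minimax risk by means of a block prior. -/
lemma le_minimaxTestRisk_of_block {σ : ℝ} (hσ : 0 < σ) (hs : 1 ≤ s) (hsd : s ≤ d)
    {Θ : Set (Fin d → ℝ)} [Fintype β] [Nonempty β] (v : β → ℝ) (hv : ∀ b, v b ≠ 0)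
    (hΘ : ∀ θ : Fin d → ℝ, numNonzero θ = s → (∀ j, θ j = 0 ∨ ∃ b, θ j = v b) → θ ∈ Θ)
    {ε w : ℝ} (hε : 0 < ε) (hw0 : 0 ≤ w)
    (hw : ∑ a, ∑ b, Real.exp (v a * v b / σ ^ 2) ≤ (Fintype.card β : ℝ) ^ 2 * (1 + w))
    (hle : 2 * (s : ℝ) ^ 2 * w ≤ d * Real.log (1 + ε ^ 2)) :
    ENNReal.ofReal (1 - ε) ≤ minimaxTestRisk d σ Θ := by
  obtain ⟨m, hm⟩ : ∃ m, m = d / s := ⟨_, rfl⟩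
  have hm0 : 0 < m := hm ▸ Nat.div_pos hsd hs
  have hsm : s * m ≤ d := hm ▸ Nat.mul_div_le d s
  -- Rounding d/s down loses at most a factor 2 because m ≥ 1; this is the 2 in `hle`.
  have hd : (d : ℝ) ≤ 2 * s * m := by
    have h1 : d < s * (m + 1) := hm ▸ Nat.lt_mul_div_succ d hs
    have h2 : d ≤ 2 * s * m := by nlinarith
    exact_mod_cast h2
  have : Nonempty (Fin m) := ⟨⟨0, hm0⟩⟩
  have hm0' : (0 : ℝ) < m := by exact_mod_cast hm0
  have hs0 : (0 : ℝ) < s := by exact_mod_cast hs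
  have hd0 : (0 : ℝ) < d := by exact_mod_cast hs.trans hsd
  have hβ : (0 : ℝ) < Fintype.card β := by exact_mod_cast Fintype.card_pos
  let e : Fin s × Fin m ↪ Fin d := finProdFinEquiv.toEmbedding.trans (Fin.castLEEmb hsm)
  refine le_minimaxTestRisk_of_family hσ (blockVector e v) (fun f => hΘ _
    (numNonzero_blockVector e hv f) (blockVector_eq_zero_or e v f)) hε ?_
  rw [sum_sum_exp_blockVector]
  have hε1 : (0 : ℝ) < 1 + ε ^ 2 := by positivity
  have hlog : s * (w / m) ≤ Real.log (1 + ε ^ 2) := by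
    rw [← mul_div_assoc, div_le_iff₀ hm0']
    refine le_of_mul_le_mul_left ?_ hd0
    calc (d : ℝ) * (s * w) ≤ 2 * s * m * (s * w) := by gcongr
      _ = m * (2 * s ^ 2 * w) := by ring
      _ ≤ m * (d * Real.log (1 + ε ^ 2)) := by gcongr
      _ = _ := by ring
  have hpow : (1 + w / m) ^ s ≤ 1 + ε ^ 2 := by
    calc (1 + w / m) ^ s ≤ Real.exp (w / m) ^ s := by
          gcongr
          linarith [Real.add_one_le_exp (w / m)]
      _ = Real.exp (s * (w / m)) := (Real.exp_nat_mul _ _).symm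
      _ ≤ Real.exp (Real.log (1 + ε ^ 2)) := Real.exp_le_exp.2 hlog
      _ = _ := Real.exp_log hε1
  have hcard : (Fintype.card (Fin s → Fin m × β) : ℝ) = ((m : ℝ) * Fintype.card β) ^ s := by
    simp
  have hm1 : (1 : ℝ) ≤ m := by exact_mod_cast hm0
  have hZ : 0 ≤ ∑ a, ∑ b, Real.exp (v a * v b / σ ^ 2) :=
    Finset.sum_nonneg fun _ _ => Finset.sum_nonneg fun _ _ => (Real.exp_pos _).le
  set Z := ∑ a, ∑ b, Real.exp (v a * v b / σ ^ 2) with hZdef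
  set b : ℝ := (Fintype.card β : ℝ)
  -- Non-negativity of the base is needed to raise the next inequality to the power s.
  have hbase : 0 ≤ (m : ℝ) ^ 2 * b ^ 2 + m * (Z - b ^ 2) := by
    have h1 : 0 ≤ (m : ℝ) * (m - 1) * b ^ 2 := by
      have := sub_nonneg.2 hm1
      positivity
    have h2 : 0 ≤ m * Z := by positivity
    linarith
  have hmul : (m : ℝ) ^ 2 * b ^ 2 + m * (Z - b ^ 2) ≤ (m * b) ^ 2 * (1 + w / m) := by
    have h1 : (m * b) ^ 2 * (1 + w / m) = (m : ℝ) ^ 2 * b ^ 2 + m * (b ^ 2 * (1 + w) - b ^ 2) := by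
      field_simp
      ring
    rw [h1]
    gcongr
  calc ((m : ℝ) ^ 2 * b ^ 2 + m * (Z - b ^ 2)) ^ s ≤ ((m * b) ^ 2 * (1 + w / m)) ^ s := by
        gcongr
    _ = ((m * b) ^ s) ^ 2 * (1 + w / m) ^ s := by rw [mul_pow, pow_right_comm]
    _ ≤ ((m * b) ^ s) ^ 2 * (1 + ε ^ 2) := by gcongr
    _ = _ := by rw [hcard]

end BlockPrior

/-! ### Lower bounds for the two classes -/

lemma minimaxTestRisk_mono {d : ℕ} {σ : ℝ} {Θ Θ' : Set (Fin d → ℝ)} (h : Θ ⊆ Θ') :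
    minimaxTestRisk d σ Θ ≤ minimaxTestRisk d σ Θ' :=
  iInf₂_mono fun _ _ => add_le_add le_rfl (biSup_mono fun _ hθ => h hθ)

lemma thetaClass_subset_thetaStarClass (d s : ℕ) {δ : ℝ} (hδ : 0 ≤ δ) :
    thetaClass d s δ ⊆ thetaStarClass d s δ := fun θ hθ => ⟨hθ.1, fun j hj => by
  rcases hθ.2 j with h | h
  · exact absurd h hj
  · rw [h, abs_of_nonneg hδ]⟩

lemma le_minimaxTestRisk_thetaClass {d s : ℕ} (hs : 1 ≤ s) (hsd : s ≤ d)
    {σ A ε : ℝ} (hσ : 0 < σ) (hε : 0 < ε) (hA : 0 < A) (hA1 : A ≤ 1)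
    (hAε : 2 * A ^ 2 ≤ Real.log (1 + ε ^ 2)) :
    ENNReal.ofReal (1 - ε) ≤ minimaxTestRisk d σ
      (thetaClass d s (A * (σ * Real.sqrt (Real.log (1 + (d : ℝ) / (s : ℝ) ^ 2))))) := by
  have hs0 : (0 : ℝ) < s := by exact_mod_cast hs
  have hd0 : (0 : ℝ) < d := by exact_mod_cast hs.trans hsd
  set r : ℝ := (d : ℝ) / (s : ℝ) ^ 2 with hr
  have hr0 : 0 < r := by positivity
  have hL : 0 < Real.log (1 + r) := Real.log_pos (by linarith)
  have hδ : 0 < A * (σ * Real.sqrt (Real.log (1 + r))) := by positivity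
  refine le_minimaxTestRisk_of_block hσ hs hsd (β := Unit)
    (fun _ => A * (σ * Real.sqrt (Real.log (1 + r)))) (fun _ => hδ.ne')
    ?_ hε (w := A ^ 2 * r) (by positivity) ?_ ?_
  · exact fun θ h1 h2 => ⟨h1, fun j => (h2 j).imp id fun ⟨_, h⟩ => h⟩
  · have h1 : A * (σ * Real.sqrt (Real.log (1 + r))) * (A * (σ * Real.sqrt (Real.log (1 + r)))) /
        σ ^ 2 = Real.log (1 + r) * A ^ 2 := by
      have := Real.mul_self_sqrt hL.le
      field_simp
      linear_combination this
    simp only [Finset.univ_unique, Finset.sum_singleton, Fintype.card_unit, Nat.cast_one, one_pow,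
      one_mul]
    -- The exponential is (1 + r)^(A²), and Bernoulli's inequality with exponent A² ≤ 1 bounds it by
    -- 1 + A²r.
    rw [h1, ← Real.rpow_def_of_pos (by linarith)]
    exact rpow_one_add_le_one_add_mul_self (by linarith) (by positivity)
      (pow_le_one₀ hA.le hA1)
  · have h1 : 2 * (s : ℝ) ^ 2 * (A ^ 2 * r) = d * (2 * A ^ 2) := by
      rw [hr]; field_simp
    rw [h1]
    gcongr

/-- Combines cosh x ≤ exp(x²/2) with e^t - 1 ≤ 2t for 0 ≤ t ≤ 1. The quadratic bound is the gain
from random signs. -/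
lemma cosh_le_one_add_sq {x : ℝ} (hx0 : 0 ≤ x) (hx : x ≤ 1) : Real.cosh x ≤ 1 + x ^ 2 := by
  have hx2 : x ^ 2 ≤ 1 := pow_le_one₀ hx0 hx
  have h := Real.abs_exp_sub_one_le (x := x ^ 2 / 2) (by rw [abs_of_nonneg (by positivity)]; linarith)
  rw [abs_of_nonneg (a := x ^ 2 / 2) (by positivity)] at h
  linarith [Real.cosh_le_exp_half_sq x, le_abs_self (Real.exp (x ^ 2 / 2) - 1)]

lemma rpow_quarter_sq {x : ℝ} (hx : 0 ≤ x) : (x ^ ((1 : ℝ) / 4)) ^ 2 = Real.sqrt x := by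
  rw [Real.sqrt_eq_rpow, ← Real.rpow_natCast, ← Real.rpow_mul hx]
  norm_num

lemma le_minimaxTestRisk_thetaStarClass_dense {d s : ℕ} (hs : 1 ≤ s) (hsd : s ≤ d)
    (hds : Real.sqrt d ≤ s)
    {σ A ε : ℝ} (hσ : 0 < σ) (hε : 0 < ε) (hA : 0 < A) (hA1 : A ≤ 1)
    (hAε : 2 * A ^ 2 ≤ Real.log (1 + ε ^ 2)) :
    ENNReal.ofReal (1 - ε) ≤ minimaxTestRisk d σ
      (thetaStarClass d s (A * (σ * (d : ℝ) ^ ((1 : ℝ) / 4) / Real.sqrt (s : ℝ)))) := by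
  have hs0 : (0 : ℝ) < s := by exact_mod_cast hs
  have hd0 : (0 : ℝ) < d := by exact_mod_cast hs.trans hsd
  set δ := A * (σ * (d : ℝ) ^ ((1 : ℝ) / 4) / Real.sqrt (s : ℝ)) with hδdef
  have hδ : 0 < δ := by positivity
  set x := A ^ 2 * (Real.sqrt d / s) with hx
  have hδ2 : δ * δ / σ ^ 2 = x := by
    have h1 := Real.sq_sqrt hs0.le
    have h2 := rpow_quarter_sq hd0.le
    rw [hx, ← h2, ← h1, hδdef]
    field_simp
  have hu : Real.sqrt d / s ≤ 1 := (div_le_one hs0).2 hds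
  have hA2 : A ^ 2 ≤ 1 := pow_le_one₀ hA.le hA1
  have hx0 : 0 ≤ x := by positivity
  have hx1 : x ≤ 1 := by
    calc x ≤ 1 * 1 := by rw [hx]; gcongr
      _ = 1 := one_mul 1
  -- The two values are ±δ with equal weight: the four pairs sum to 4 cosh x.
  refine le_minimaxTestRisk_of_block hσ hs hsd (β := Bool)
    (fun b => if b then δ else -δ) (fun b => by cases b <;> simp [hδ.ne'])
    ?_ hε (w := x ^ 2) (by positivity) ?_ ?_
  · refine fun θ h1 h2 => ⟨h1, fun j hj => ?_⟩
    rcases h2 j with h | ⟨b, h⟩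
    · exact absurd h hj
    · rw [h]
      cases b <;> simp [abs_of_pos hδ]
  · have h1 : -δ * δ / σ ^ 2 = -x := by rw [← hδ2]; ring
    have h2 : δ * -δ / σ ^ 2 = -x := by rw [← hδ2]; ring
    have h3 : -δ * -δ / σ ^ 2 = x := by rw [← hδ2]; ring
    simp only [Fintype.sum_bool, if_true, Bool.false_eq_true, if_false, h1, h2, h3, hδ2,
      Fintype.card_bool]
    have := cosh_le_one_add_sq hx0 hx1
    rw [Real.cosh_eq] at this
    push_cast
    linarith
  · have h1 : 2 * (s : ℝ) ^ 2 * x ^ 2 = d * (2 * (A ^ 2) ^ 2) := by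
      rw [hx, mul_pow, div_pow, Real.sq_sqrt hd0.le]
      field_simp
    rw [h1]
    have : (A ^ 2) ^ 2 ≤ A ^ 2 := by rw [sq (A ^ 2)]; exact mul_le_of_le_one_left (by positivity) hA2
    gcongr
    linarith

/-! ### Tests based on a sum over coordinates -/

/-- Chebyshev's inequality for a sum of functions of independent coordinates. -/
lemma pi_measure_abs_sub_ge_le {d : ℕ} (μ : Fin d → Measure ℝ) [∀ j, IsProbabilityMeasure (μ j)]
    {f : ℝ → ℝ} (hf : ∀ j, MemLp f 2 (μ j)) {c : ℝ} (hc : 0 < c) :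
    Measure.pi μ {y | c ≤ |∑ j, f (y j) - ∑ j, ∫ x, f x ∂μ j|} ≤
      ENNReal.ofReal ((∑ j, Var[f; μ j]) / c ^ 2) := by
  have hLp : ∀ j, MemLp (fun y : Fin d → ℝ => f (y j)) 2 (Measure.pi μ) := fun j =>
    (hf j).comp_measurePreserving (measurePreserving_eval μ j)
  have hsum : MemLp (∑ j, fun y : Fin d → ℝ => f (y j)) 2 (Measure.pi μ) :=
    memLp_finsetSum' _ fun j _ => hLp j
  have h := meas_ge_le_variance_div_sq hsum hc
  rw [variance_sum_pi hf] at h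
  simp only [Finset.sum_apply] at h
  rw [integral_finsetSum _ fun j _ => (hLp j).integrable (by norm_num)] at h
  have hint : ∀ j, ∫ y, f (y j) ∂Measure.pi μ = ∫ x, f x ∂μ j := by
    intro j
    have hm := (measurePreserving_eval μ j).map_eq
    conv_rhs => rw [← hm]
    rw [integral_map (measurable_pi_apply j).aemeasurable (hm ▸ (hf j).aestronglyMeasurable)]
  simpa only [hint] using h

/-- Risk of the test that rejects for large values of `∑ j, f (y j)`. -/
lemma minimaxTestRisk_le_of_statistic {d : ℕ} {σ : ℝ} {Θ : Set (Fin d → ℝ)} {f : ℝ → ℝ}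
    (hf : Measurable f) (hLp : ∀ a, MemLp f 2 (gaussianReal a (Real.toNNReal (σ ^ 2))))
    {t ε : ℝ} (ht : 0 < t) (hε : 0 < ε)
    (h0 : d * Var[f; gaussianReal 0 (Real.toNNReal (σ ^ 2))] ≤ ε / 2 * t ^ 2)
    (h1 : ∀ θ ∈ Θ, 2 * t ≤ ∑ j, (∫ x, f x ∂gaussianReal (θ j) (Real.toNNReal (σ ^ 2)) -
      ∫ x, f x ∂gaussianReal 0 (Real.toNNReal (σ ^ 2))))
    (h2 : ∀ θ ∈ Θ, ∑ j, Var[f; gaussianReal (θ j) (Real.toNNReal (σ ^ 2))] ≤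
      ε / 2 * (∑ j, (∫ x, f x ∂gaussianReal (θ j) (Real.toNNReal (σ ^ 2)) -
        ∫ x, f x ∂gaussianReal 0 (Real.toNNReal (σ ^ 2))) - t) ^ 2) :
    minimaxTestRisk d σ Θ ≤ ENNReal.ofReal ε := by
  set m : ℝ → ℝ := fun a => ∫ x, f x ∂gaussianReal a (Real.toNNReal (σ ^ 2)) with hm
  -- The threshold exceeds the null mean by t; each error is allotted ε/2.
  set T : ℝ := d * m 0 + t with hT
  have hS : Measurable fun y : Fin d → ℝ => ∑ j, f (y j) :=
    Finset.measurable_sum _ fun j _ => hf.comp (measurable_pi_apply j)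
  classical
  set Δ : (Fin d → ℝ) → Fin 2 := fun y => if T ≤ ∑ j, f (y j) then 1 else 0 with hΔ
  have hΔm : Measurable Δ :=
    Measurable.ite (measurableSet_le measurable_const hS) measurable_const measurable_const
  have hΔ1 : {y | Δ y = 1} = {y | T ≤ ∑ j, f (y j)} := by
    ext y; simp [hΔ]
  have hΔ0 : {y | Δ y = 0} = {y | ∑ j, f (y j) < T} := by
    ext y; simp [hΔ]
  have hhalf : ENNReal.ofReal ε = ENNReal.ofReal (ε / 2) + ENNReal.ofReal (ε / 2) := by
    rw [← ENNReal.ofReal_add (by positivity) (by positivity), add_halves]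
  refine (iInf₂_le Δ hΔm).trans ?_
  unfold testRisk
  rw [hhalf, hΔ1, hΔ0]
  refine add_le_add ?_ (iSup₂_le fun θ hθ => ?_)
  · have h := pi_measure_abs_sub_ge_le
      (fun j : Fin d => gaussianReal ((0 : Fin d → ℝ) j) (Real.toNNReal (σ ^ 2)))
      (fun j => hLp _) ht
    refine ((measure_mono fun y hy => ?_).trans h).trans (ENNReal.ofReal_le_ofReal ?_)
    · have hy' : T ≤ ∑ j, f (y j) := hy
      rw [Set.mem_ofPred_eq]
      refine le_trans ?_ (le_abs_self _)
      simp only [Pi.zero_apply, Finset.sum_const, Finset.card_univ, Fintype.card_fin, nsmul_eq_mul]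
      linarith
    · simp only [Pi.zero_apply, Finset.sum_const, Finset.card_univ, Fintype.card_fin, nsmul_eq_mul]
      rwa [div_le_iff₀ (by positivity)]
  · have hG := h1 θ hθ
    have hV := h2 θ hθ
    set G := ∑ j, (m (θ j) - m 0) with hGdef
    have hGt : 0 < G - t := by linarith
    have h := pi_measure_abs_sub_ge_le
      (fun j : Fin d => gaussianReal (θ j) (Real.toNNReal (σ ^ 2))) (fun j => hLp _) hGt
    refine ((measure_mono fun y hy => ?_).trans h).trans (ENNReal.ofReal_le_ofReal ?_)
    · have hy' : ∑ j, f (y j) < T := hy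
      rw [Set.mem_ofPred_eq]
      refine le_trans ?_ (neg_le_abs _)
      have : ∑ j, m (θ j) = G + d * m 0 := by
        rw [hGdef, Finset.sum_sub_distrib]; simp
      change G - t ≤ -(∑ j, f (y j) - ∑ j, m (θ j))
      linarith
    · rwa [div_le_iff₀ (by positivity)]

/-! ### The counting test -/

lemma gaussianReal_abs_ge_le (v : NNReal) {T : ℝ} (hT : 0 ≤ T) :
    (gaussianReal 0 v).real {x | T ≤ |x|} ≤ 2 * Real.exp (-T ^ 2 / (2 * v)) := by
  have h : HasSubgaussianMGF (fun x => x) v (gaussianReal 0 v) :=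
    ⟨fun t => integrable_exp_mul_gaussianReal t, fun t => by
      simp [mgf_fun_id_gaussianReal]⟩
  have h1 := h.measure_ge_le hT
  have h2 := h.neg.measure_ge_le hT
  have hsub : {x : ℝ | T ≤ |x|} ⊆ {x | T ≤ x} ∪ {x | T ≤ (-fun x => x) x} := by
    intro x hx
    have hx' : T ≤ |x| := hx
    exact le_abs.1 hx'
  have h3 := (measureReal_mono (μ := gaussianReal 0 v) hsub).trans (measureReal_union_le _ _)
  linarith

/-- A signal of size at least 2T is missed only if the noise itself reaches T, so one tail bound
controls both kinds of coordinate. -/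
lemma gaussianReal_abs_lt_le (v : NNReal) {a T : ℝ} (ha : 2 * T ≤ |a|) :
    (gaussianReal a v).real {x | |x| < T} ≤ (gaussianReal 0 v).real {x | T ≤ |x|} := by
  have hmap : gaussianReal a v = (gaussianReal 0 v).map (a + ·) := by
    rw [gaussianReal_map_const_add, zero_add]
  rw [hmap, map_measureReal_apply (by fun_prop)
    (measurableSet_lt (by fun_prop) measurable_const)]
  refine measureReal_mono fun x hx => ?_
  have hx' : |a + x| < T := hx
  change T ≤ |x|
  have : |a| ≤ |a + x| + |x| := by simpa using abs_sub (a + x) x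
  linarith

/-- Counting test: `q` bounds the probability that a pure noise coordinate exceeds `T`. -/
lemma minimaxTestRisk_thetaStarClass_le_of_count {d s : ℕ} {σ δ T ε q : ℝ} (hs : 1 ≤ s)
    (hT : 2 * T ≤ δ) (hε : 0 < ε)
    (hq : (gaussianReal 0 (Real.toNNReal (σ ^ 2))).real {x | T ≤ |x|} ≤ q) (hq4 : q ≤ 1 / 4)
    (hdq : 32 * (d * q) ≤ ε * s ^ 2) :
    minimaxTestRisk d σ (thetaStarClass d s δ) ≤ ENNReal.ofReal ε := by
  set v := Real.toNNReal (σ ^ 2)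
  have hs0 : (0 : ℝ) < s := by exact_mod_cast hs
  set S : Set ℝ := {x | T ≤ |x|} with hSdef
  have hS : MeasurableSet S := measurableSet_le measurable_const (by fun_prop)
  set f : ℝ → ℝ := S.indicator fun _ => 1 with hfdef
  have hf : Measurable f := measurable_const.indicator hS
  have hint : ∀ a, ∫ x, f x ∂gaussianReal a v = (gaussianReal a v).real S := fun a =>
    integral_indicator_one hS
  have hLp : ∀ a, MemLp f 2 (gaussianReal a v) := fun a =>
    (memLp_const 1).indicator hS
  have hSc : Sᶜ = {x | |x| < T} := by ext x; simp [hSdef]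
  have hcompl : ∀ a, δ ≤ |a| → (gaussianReal a v).real Sᶜ ≤ q := fun a ha => by
    rw [hSc]; exact (gaussianReal_abs_lt_le v (hT.trans ha)).trans hq
  have hvar1 : ∀ a, Var[f; gaussianReal a v] ≤ (gaussianReal a v).real S := by
    intro a
    refine (variance_le_expectation_sq (hLp a).aestronglyMeasurable).trans_eq ?_
    rw [← hint a]
    congr 1
    ext x
    by_cases hx : x ∈ S <;> simp [hfdef, hx]
  -- Passing to 1 - f shows that the variance is also small when exceedance is likely; thus signal
  -- coordinates, like null ones, have variance at most q.
  have hvar2 : ∀ a, Var[f; gaussianReal a v] ≤ (gaussianReal a v).real Sᶜ := by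
    intro a
    rw [← variance_const_sub (hLp a).aestronglyMeasurable 1]
    refine (variance_le_expectation_sq
      (aestronglyMeasurable_const.sub (hLp a).aestronglyMeasurable)).trans_eq ?_
    rw [← integral_indicator_one hS.compl]
    congr 1
    ext x
    by_cases hx : x ∈ S <;> simp [hfdef, hx]
  have hvar0 : Var[f; gaussianReal 0 v] ≤ q := (hvar1 0).trans hq
  have hbound : (d : ℝ) * q ≤ ε / 2 * (s / 4 : ℝ) ^ 2 := by
    have : ε / 2 * (s / 4 : ℝ) ^ 2 = ε * s ^ 2 / 32 := by ring
    rw [this]; linarith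
  -- Each signal coordinate gains at least (1 - q) - q ≥ 1/2, hence s/2 in total and t = s/4.
  have hmean : ∀ θ ∈ thetaStarClass d s δ, 2 * (s / 4 : ℝ) ≤
      ∑ j, (∫ x, f x ∂gaussianReal (θ j) v - ∫ x, f x ∂gaussianReal 0 v) := by
    intro θ hθ
    have hle : ∀ j, (if θ j ≠ 0 then (1 / 2 : ℝ) else 0) ≤
        ∫ x, f x ∂gaussianReal (θ j) v - ∫ x, f x ∂gaussianReal 0 v := by
      intro j
      split_ifs with hj
      · rw [hint, hint]
        have h1 := hcompl _ (hθ.2 j hj)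
        rw [probReal_compl_eq_one_sub hS] at h1
        linarith
      · rw [not_not.1 hj, sub_self]
    refine le_trans (le_of_eq ?_) (Finset.sum_le_sum fun j _ => hle j)
    rw [← Finset.sum_filter, Finset.sum_const, nsmul_eq_mul]
    have : (Finset.univ.filter fun j => θ j ≠ 0).card = s := hθ.1
    rw [this]; ring
  refine minimaxTestRisk_le_of_statistic hf hLp (t := s / 4) (by positivity) hε ?_ hmean ?_
  · exact le_trans (by gcongr) hbound
  · intro θ hθ
    have hvar : ∀ j, Var[f; gaussianReal (θ j) v] ≤ q := by
      intro j
      by_cases hj : θ j = 0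
      · rw [hj]; exact hvar0
      · exact (hvar2 _).trans (hcompl _ (hθ.2 j hj))
    have h1 := hmean θ hθ
    calc ∑ j, Var[f; gaussianReal (θ j) v] ≤ ∑ _j : Fin d, q := Finset.sum_le_sum fun j _ => hvar j
      _ = d * q := by simp
      _ ≤ ε / 2 * (s / 4 : ℝ) ^ 2 := hbound
      _ ≤ _ := by
        gcongr
        linarith

/-! ### The chi-square test -/

/-- The variance of the square of a standard normal variable. -/
noncomputable def chiSqVariance : ℝ := ∫ x, (x ^ 2 - 1) ^ 2 ∂gaussianReal 0 1

lemma chiSqVariance_nonneg : 0 ≤ chiSqVariance := integral_nonneg fun _ => sq_nonneg _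

lemma memLp_sq_gaussianReal (a : ℝ) (v : NNReal) :
    MemLp (fun x : ℝ => x ^ 2) 2 (gaussianReal a v) := by
  rw [memLp_two_iff_integrable_sq (by fun_prop)]
  have h := (memLp_id_gaussianReal (μ := a) (v := v) (4 : ℕ)).integrable_norm_pow (by norm_num)
  refine h.congr (Filter.Eventually.of_forall fun x => ?_)
  change ‖x‖ ^ 4 = (x ^ 2) ^ 2
  rw [Real.norm_eq_abs, Even.pow_abs (by decide)]
  ring

lemma integral_sq_gaussianReal (a : ℝ) (v : NNReal) :
    ∫ x, x ^ 2 ∂gaussianReal a v = a ^ 2 + v := by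
  have h := variance_eq_sub (memLp_id_gaussianReal (μ := a) (v := v) 2)
  rw [variance_id_gaussianReal] at h
  simp only [id, integral_id_gaussianReal, Pi.pow_apply] at h
  linarith

lemma variance_sq_gaussianReal_one_le (a : ℝ) :
    Var[fun x => x ^ 2; gaussianReal a 1] ≤ 2 * chiSqVariance + 8 * a ^ 2 := by
  have hmap : gaussianReal a 1 = (gaussianReal 0 1).map (a + ·) := by
    rw [gaussianReal_map_const_add, zero_add]
  have hsq := memLp_sq_gaussianReal 0 1
  have h2 : Integrable (fun x : ℝ => x ^ 2) (gaussianReal 0 1) := hsq.integrable (by norm_num)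
  have h4 : Integrable (fun x : ℝ => (x ^ 2 - 1) ^ 2) (gaussianReal 0 1) :=
    (hsq.sub (memLp_const 1)).integrable_sq
  have hm : ∫ x, x ^ 2 ∂gaussianReal a 1 = a ^ 2 + 1 := by
    rw [integral_sq_gaussianReal]; simp
  rw [variance_eq_integral (by fun_prop), hm, hmap, integral_map (by fun_prop) (by fun_prop)]
  calc ∫ x, ((a + x) ^ 2 - (a ^ 2 + 1)) ^ 2 ∂gaussianReal 0 1
      ≤ ∫ x, (2 * (x ^ 2 - 1) ^ 2 + 8 * a ^ 2 * x ^ 2) ∂gaussianReal 0 1 := by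
        refine integral_mono_of_nonneg (Filter.Eventually.of_forall fun x => sq_nonneg _)
          ((h4.const_mul 2).add (h2.const_mul _)) (Filter.Eventually.of_forall fun x => ?_)
        -- This is (p + q)² ≤ 2p² + 2q² with p = x² - 1 and q = 2ax.
        have : 0 ≤ (x ^ 2 - 1 - 2 * a * x) ^ 2 := sq_nonneg _
        change ((a + x) ^ 2 - (a ^ 2 + 1)) ^ 2 ≤ 2 * (x ^ 2 - 1) ^ 2 + 8 * a ^ 2 * x ^ 2
        linarith
    _ = 2 * chiSqVariance + 8 * a ^ 2 := by
        rw [integral_add (h4.const_mul 2) (h2.const_mul _), integral_const_mul,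
          integral_const_mul, integral_sq_gaussianReal, chiSqVariance]
        simp

lemma gaussianReal_map_div_self {σ : ℝ} (hσ : 0 < σ) (a : ℝ) :
    (gaussianReal a (Real.toNNReal (σ ^ 2))).map (· / σ) = gaussianReal (a / σ) 1 := by
  rw [gaussianReal_map_div_const]
  congr 1
  ext
  simp [hσ.ne', Real.coe_toNNReal _ (sq_nonneg σ)]

lemma variance_div_sq_gaussianReal_le {σ : ℝ} (hσ : 0 < σ) (a : ℝ) :
    Var[fun x => (x / σ) ^ 2; gaussianReal a (Real.toNNReal (σ ^ 2))] ≤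
      2 * chiSqVariance + 8 * (a / σ) ^ 2 := by
  have h := variance_sq_gaussianReal_one_le (a / σ)
  rw [← gaussianReal_map_div_self hσ, variance_map (by fun_prop) (by fun_prop)] at h
  exact h

lemma integral_div_sq_gaussianReal {σ : ℝ} (hσ : 0 < σ) (a : ℝ) :
    ∫ x, (x / σ) ^ 2 ∂gaussianReal a (Real.toNNReal (σ ^ 2)) = (a / σ) ^ 2 + 1 := by
  have h := integral_sq_gaussianReal (a / σ) 1
  rw [← gaussianReal_map_div_self hσ, integral_map (by fun_prop) (by fun_prop)] at h
  simpa using h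

/-- Chi-square test. -/
lemma minimaxTestRisk_thetaStarClass_dense_le {d s : ℕ} (hs : 1 ≤ s) (hsd : s ≤ d)
    {σ A ε : ℝ} (hσ : 0 < σ) (hε : 0 < ε) (hA : 0 < A)
    (hAε : 1 + (32 * chiSqVariance + 128) / ε ≤ A ^ 2) :
    minimaxTestRisk d σ
      (thetaStarClass d s (A * (σ * (d : ℝ) ^ ((1 : ℝ) / 4) / Real.sqrt (s : ℝ)))) ≤
        ENNReal.ofReal ε := by
  have hs0 : (0 : ℝ) < s := by exact_mod_cast hs
  have hd1 : (1 : ℝ) ≤ d := by exact_mod_cast hs.trans hsd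
  have hd0 : (0 : ℝ) < d := by linarith
  have hV := chiSqVariance_nonneg
  set V := chiSqVariance
  set δ := A * (σ * (d : ℝ) ^ ((1 : ℝ) / 4) / Real.sqrt (s : ℝ)) with hδdef
  have hδ : 0 < δ := by positivity
  set a := A ^ 2 with ha
  set u := Real.sqrt d with hu
  have hu2 : u ^ 2 = d := Real.sq_sqrt hd0.le
  have hu1 : 1 ≤ u := Real.one_le_sqrt.2 hd1
  have hsδ : s * (δ / σ) ^ 2 = a * u := by
    have h1 := Real.sq_sqrt hs0.le
    have h2 := rpow_quarter_sq hd0.le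
    rw [ha, hu, ← h2, hδdef]
    field_simp
    rw [h1]
  have hdiv : 0 ≤ (32 * V + 128) / ε := by positivity
  -- The summand 1 in `hAε` gives a ≥ 1, which upgrades the bound by ε·a to one by ε·a².
  have ha1 : 1 ≤ a := by linarith
  have haε : 32 * V + 128 ≤ ε * a := by
    have := (div_le_iff₀ hε).1 (show (32 * V + 128) / ε ≤ a by linarith)
    linarith
  have haV : 32 * V ≤ ε * a ^ 2 := by nlinarith [mul_nonneg hε.le (sub_nonneg.2 ha1)]
  have hgain : ∀ θ : Fin d → ℝ,
      ∑ j, (∫ x, (x / σ) ^ 2 ∂gaussianReal (θ j) (Real.toNNReal (σ ^ 2)) -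
        ∫ x, (x / σ) ^ 2 ∂gaussianReal 0 (Real.toNNReal (σ ^ 2))) = ∑ j, (θ j / σ) ^ 2 := by
    intro θ
    refine Finset.sum_congr rfl fun j _ => ?_
    rw [integral_div_sq_gaussianReal hσ, integral_div_sq_gaussianReal hσ]
    simp
  have hle : ∀ θ ∈ thetaStarClass d s δ, a * u ≤ ∑ j, (θ j / σ) ^ 2 := by
    intro θ hθ
    have hj : ∀ j, (if θ j ≠ 0 then (δ / σ) ^ 2 else 0) ≤ (θ j / σ) ^ 2 := by
      intro j
      split_ifs with hj
      · rw [← sq_abs (θ j / σ), abs_div, abs_of_pos hσ]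
        have := hθ.2 j hj
        gcongr
      · positivity
    refine le_trans (le_of_eq ?_) (Finset.sum_le_sum fun j _ => hj j)
    rw [← Finset.sum_filter, Finset.sum_const, nsmul_eq_mul]
    have : (Finset.univ.filter fun j => θ j ≠ 0).card = s := hθ.1
    rw [this, hsδ]
  refine minimaxTestRisk_le_of_statistic (f := fun x => (x / σ) ^ 2) (t := a * u / 2)
    (by fun_prop) (fun b => ?_) (by positivity) hε ?_ ?_ ?_
  · have := (memLp_sq_gaussianReal b (Real.toNNReal (σ ^ 2))).const_mul (1 / σ ^ 2)
    refine this.ae_eq (Filter.Eventually.of_forall fun x => ?_)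
    simp only [div_pow]
    ring
  · have h := variance_div_sq_gaussianReal_le hσ 0
    have h' : Var[fun x => (x / σ) ^ 2; gaussianReal 0 (Real.toNNReal (σ ^ 2))] ≤ 2 * V := by
      simpa using h
    calc (d : ℝ) * Var[fun x => (x / σ) ^ 2; gaussianReal 0 (Real.toNNReal (σ ^ 2))]
        ≤ d * (2 * V) := by gcongr
      _ ≤ d * (ε * a ^ 2 / 8) := by gcongr; linarith
      _ = ε / 2 * (a * u / 2) ^ 2 := by rw [← hu2]; ring
  · intro θ hθ
    rw [hgain]
    linarith [hle θ hθ]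
  · intro θ hθ
    rw [hgain]
    have hμ := hle θ hθ
    set μ := ∑ j, (θ j / σ) ^ 2 with hμdef
    have h1 : ∑ j, Var[fun x => (x / σ) ^ 2; gaussianReal (θ j) (Real.toNNReal (σ ^ 2))] ≤
        2 * V * d + 8 * μ := by
      refine (Finset.sum_le_sum fun j _ => variance_div_sq_gaussianReal_le hσ (θ j)).trans_eq ?_
      rw [Finset.sum_add_distrib, Finset.sum_const, nsmul_eq_mul, Finset.card_univ,
        Fintype.card_fin, ← Finset.mul_sum]
      change (d : ℝ) * (2 * V) + 8 * μ = 2 * V * d + 8 * μ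
      ring
    have hau : 0 < a * u := by positivity
    have hμ0 : 0 < μ := hau.trans_le hμ
    -- The noise variance and the signal-dependent variance each get εμ²/16, together (ε/2)(μ/2)².
    -- The latter is enough because t is at most μ/2.
    have h2 : 2 * V * d ≤ ε * μ ^ 2 / 16 := by
      have h3 : (a * u) ^ 2 ≤ μ ^ 2 := by gcongr
      rw [mul_pow, hu2] at h3
      have h4 : 32 * V * d ≤ ε * a ^ 2 * d := by gcongr
      have h5 : ε * (a ^ 2 * d) ≤ ε * μ ^ 2 := by gcongr
      linarith
    have h3 : 8 * μ ≤ ε * μ ^ 2 / 16 := by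
      have h4 : a ≤ μ := (le_mul_of_one_le_right (by linarith) hu1).trans hμ
      have h5 : 128 ≤ ε * μ := by
        have : ε * a ≤ ε * μ := by gcongr
        linarith
      have : 128 * μ ≤ ε * μ * μ := by gcongr
      linarith
    have h4 : (μ / 2) ^ 2 ≤ (μ - a * u / 2) ^ 2 := by
      gcongr
      linarith
    have h5 : ε / 2 * (μ / 2) ^ 2 ≤ ε / 2 * (μ - a * u / 2) ^ 2 := by gcongr
    linarith

/-! ### Sparse upper bound, constants and conclusion -/

lemma one_le_div_sq {d s : ℕ} (hs : 1 ≤ s) (h : (s : ℝ) ≤ Real.sqrt d) :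
    1 ≤ (d : ℝ) / (s : ℝ) ^ 2 := by
  have hs0 : (0 : ℝ) < s := by exact_mod_cast hs
  rw [one_le_div (by positivity), ← Real.sq_sqrt (Nat.cast_nonneg d)]
  gcongr

/-- The counting test at T = δ/2 has q = 2exp(-A²L/8) with L = log(1 + r) and r = d/s². As dq =
s²·rq, it only remains to make rq small. -/
lemma minimaxTestRisk_thetaStarClass_sparse_le {d s : ℕ} (hs : 1 ≤ s)
    (hds : (s : ℝ) ≤ Real.sqrt d) {σ A ε : ℝ} (hσ : 0 < σ) (hε : 0 < ε) (hε1 : ε < 1) (hA : 0 < A)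
    (hAε : 8 * (1 + 128 / ε) ≤ A ^ 2) :
    minimaxTestRisk d σ
      (thetaStarClass d s (A * (σ * Real.sqrt (Real.log (1 + (d : ℝ) / (s : ℝ) ^ 2))))) ≤
        ENNReal.ofReal ε := by
  have hs0 : (0 : ℝ) < s := by exact_mod_cast hs
  have hr := one_le_div_sq hs hds
  have hdr : (d : ℝ) = d / (s : ℝ) ^ 2 * s ^ 2 := by field_simp
  set r : ℝ := (d : ℝ) / (s : ℝ) ^ 2
  have hL2 : 1 / 2 ≤ Real.log (1 + r) := by
    have h1 : Real.log 2 ≤ Real.log (1 + r) := Real.log_le_log (by norm_num) (by linarith)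
    linarith [Real.log_two_gt_d9]
  set L := Real.log (1 + r) with hLdef
  have hexpL : Real.exp L = 1 + r := Real.exp_log (by linarith)
  set T := A * (σ * Real.sqrt L) / 2 with hTdef
  have hT0 : 0 ≤ T := by positivity
  have hq := gaussianReal_abs_ge_le (Real.toNNReal (σ ^ 2)) hT0
  have hexp : -T ^ 2 / (2 * (Real.toNNReal (σ ^ 2) : ℝ)) = -(A ^ 2 / 8 * L) := by
    rw [Real.coe_toNNReal _ (sq_nonneg σ), hTdef]
    have := Real.sq_sqrt (show 0 ≤ L by linarith)
    field_simp
    rw [this]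
    ring
  rw [hexp] at hq
  -- The factor r costs at most e^L; since L ≥ 1/2, the remaining exponent is at least 64/ε, and
  -- e^(-x) ≤ 1/x finishes.
  have hrq : r * (2 * Real.exp (-(A ^ 2 / 8 * L))) ≤ ε / 32 := by
    have h1 : r * (2 * Real.exp (-(A ^ 2 / 8 * L))) ≤ 2 * Real.exp (-(64 / ε)) := by
      calc r * (2 * Real.exp (-(A ^ 2 / 8 * L)))
          ≤ Real.exp L * (2 * Real.exp (-(A ^ 2 / 8 * L))) := by gcongr; linarith
        _ = 2 * Real.exp (-((A ^ 2 / 8 - 1) * L)) := by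
            rw [mul_left_comm, ← Real.exp_add]; ring_nf
        _ ≤ 2 * Real.exp (-(64 / ε)) := by
            have h2 : 128 / ε * (1 / 2) ≤ (A ^ 2 / 8 - 1) * L := by
              have h3 : 128 / ε ≤ A ^ 2 / 8 - 1 := by linarith
              have : 0 ≤ 128 / ε := by positivity
              gcongr
              linarith
            have h3 : 128 / ε * (1 / 2) = 64 / ε := by ring
            gcongr
            linarith
    have h2 : Real.exp (-(64 / ε)) ≤ ε / 64 := by
      rw [Real.exp_neg, inv_le_comm₀ (Real.exp_pos _) (by positivity), inv_div]
      linarith [Real.add_one_le_exp (64 / ε)]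
    linarith
  have hq0 := Real.exp_pos (-(A ^ 2 / 8 * L))
  refine minimaxTestRisk_thetaStarClass_le_of_count hs (T := T) (by rw [hTdef]; linarith) hε hq ?_ ?_
  · have : 1 * (2 * Real.exp (-(A ^ 2 / 8 * L))) ≤ r * (2 * Real.exp (-(A ^ 2 / 8 * L))) := by
      gcongr
    linarith
  · set q := 2 * Real.exp (-(A ^ 2 / 8 * L))
    calc 32 * (d * q) = 32 * (r * q) * s ^ 2 := by rw [hdr]; ring
      _ ≤ ε * s ^ 2 := by gcongr; linarith

lemma log_rate_pos {d s : ℕ} (hs : 1 ≤ s) (hsd : s ≤ d) {σ : ℝ} (hσ : 0 < σ) :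
    0 < σ * Real.sqrt (Real.log (1 + (d : ℝ) / (s : ℝ) ^ 2)) := by
  have hs0 : (0 : ℝ) < s := by exact_mod_cast hs
  have hd0 : (0 : ℝ) < d := by exact_mod_cast hs.trans hsd
  have : 0 < (d : ℝ) / (s : ℝ) ^ 2 := by positivity
  have := Real.log_pos (show 1 < 1 + (d : ℝ) / (s : ℝ) ^ 2 by linarith)
  positivity

/-- The upper constant can be any number whose square exceeds a given bound. -/
lemma exists_pos_forall_le_sq (c : ℝ) : ∃ A₀ : ℝ, 0 < A₀ ∧ ∀ A, A₀ < A → c ≤ A ^ 2 := by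
  refine ⟨|c| + 1, by positivity, fun A hA => ?_⟩
  have := abs_nonneg c
  nlinarith [le_abs_self c]

lemma exists_pos_forall_sq_le {ε : ℝ} (hε : 0 < ε) : ∃ a₀ : ℝ, 0 < a₀ ∧ ∀ A, 0 < A → A < a₀ →
    A ≤ 1 ∧ 2 * A ^ 2 ≤ Real.log (1 + ε ^ 2) := by
  have hl : 0 < Real.log (1 + ε ^ 2) := Real.log_pos (by have := sq_pos_of_pos hε; linarith)
  -- For A ≤ 1 one has 2A² ≤ 2A, so a bound linear in A avoids a square root.
  refine ⟨min 1 (Real.log (1 + ε ^ 2) / 2), by positivity, fun A hA hA0 => ?_⟩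
  have h1 := hA0.le.trans (min_le_left _ _)
  have h2 := hA0.le.trans (min_le_right _ _)
  exact ⟨h1, by nlinarith⟩

theorem corollary2 :
    IsMinimaxTestingRate
      (fun d s => 1 ≤ s ∧ s ≤ d ∧ (s : ℝ) ≤ Real.sqrt (d : ℝ))
      thetaClass
      (fun d s σ => σ * Real.sqrt (Real.log (1 + (d : ℝ) / (s : ℝ) ^ 2))) ∧
    IsMinimaxTestingRate
      (fun d s => 1 ≤ s ∧ s ≤ d)
      thetaStarClass
      (fun d s σ =>
        if (s : ℝ) < Real.sqrt (d : ℝ) then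
          σ * Real.sqrt (Real.log (1 + (d : ℝ) / (s : ℝ) ^ 2))
        else
          σ * (d : ℝ) ^ ((1 : ℝ) / 4) / Real.sqrt (s : ℝ)) := by
  refine ⟨⟨fun d s σ h hσ => log_rate_pos h.1 h.2.1 hσ, fun ε hε hε1 => ?_, fun ε hε _ => ?_⟩,
    ⟨fun d s σ h hσ => ?_, fun ε hε hε1 => ?_, fun ε hε _ => ?_⟩⟩
  · obtain ⟨A₀, hA₀, hA⟩ := exists_pos_forall_le_sq (8 * (1 + 128 / ε))
    refine ⟨A₀, hA₀, fun d s σ h hσ A hAA => ?_⟩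
    have hA0 := hA₀.trans hAA
    have hrate := log_rate_pos h.1 h.2.1 hσ
    exact (minimaxTestRisk_mono (thetaClass_subset_thetaStarClass d s (by positivity))).trans
      (minimaxTestRisk_thetaStarClass_sparse_le h.1 h.2.2 hσ hε hε1 hA0 (hA A hAA))
  · obtain ⟨a₀, ha₀, ha⟩ := exists_pos_forall_sq_le hε
    refine ⟨a₀, ha₀, fun d s σ h hσ A hA0 hAa => ?_⟩
    obtain ⟨hA1, hAε⟩ := ha A hA0 hAa
    exact le_minimaxTestRisk_thetaClass h.1 h.2.1 hσ hε hA0 hA1 hAε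
  · have hs0 : (0 : ℝ) < s := by exact_mod_cast h.1
    have hd0 : (0 : ℝ) < d := by exact_mod_cast h.1.trans h.2
    dsimp only
    split_ifs
    · exact log_rate_pos h.1 h.2 hσ
    · positivity
  · obtain ⟨A₁, hA₁, h1⟩ := exists_pos_forall_le_sq (8 * (1 + 128 / ε))
    obtain ⟨A₂, hA₂, h2⟩ := exists_pos_forall_le_sq (1 + (32 * chiSqVariance + 128) / ε)
    refine ⟨max A₁ A₂, lt_max_of_lt_left hA₁, fun d s σ h hσ A hAA => ?_⟩
    have hAA₁ := (le_max_left _ _).trans_lt hAA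
    have hAA₂ := (le_max_right _ _).trans_lt hAA
    dsimp only
    split_ifs with hds
    · exact minimaxTestRisk_thetaStarClass_sparse_le h.1 hds.le hσ hε hε1 (hA₁.trans hAA₁)
        (h1 A hAA₁)
    · exact minimaxTestRisk_thetaStarClass_dense_le h.1 h.2 hσ hε (hA₁.trans hAA₁) (h2 A hAA₂)
  · obtain ⟨a₀, ha₀, ha⟩ := exists_pos_forall_sq_le hε
    refine ⟨a₀, ha₀, fun d s σ h hσ A hA0 hAa => ?_⟩
    obtain ⟨hA1, hAε⟩ := ha A hA0 hAa
    dsimp only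
    split_ifs with hds
    · have hrate := log_rate_pos h.1 h.2 hσ
      exact (le_minimaxTestRisk_thetaClass h.1 h.2 hσ hε hA0 hA1 hAε).trans
        (minimaxTestRisk_mono (thetaClass_subset_thetaStarClass d s (by positivity)))
    · exact le_minimaxTestRisk_thetaStarClass_dense h.1 h.2 (not_lt.1 hds) hσ hε hA0 hA1 hAε
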